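/- Consider the additively split system $y'=F(y)=\sum_{q=1}^{P} f^{(q)}(y)$ on $[t_0,t_F]$, $t_0<t_F$, where all $f^{(q)}:\mathbb{R}^d\to\mathbb{R}^d$ are smooth, with an exact solution $y(t)$ on $[t_0,t_F]$, and a differentiable goal function $Q:\mathbb{R}^d\to\mathbb{R}$ with Jacobian $Q_y$. Let $J^{(q)}$ be the Jacobian of $f^{(q)}$. The continuous adjoint $\overline\lambda$ is the solution of $$\overline\lambda'=-\sum_{q=1}^{P}\bigl(J^{(q)}(y(t))\bigr)^{\top}\overline\lambda,\qquad \overline\lambda(t_F)=\bigl(Q_y(y(t_F))\bigr)^{\top}.$$ A GARK scheme with real coefficients $a^{(q,m)}_{i,j}$, $b^{(q)}_i$ ($1\le q,m\le P$, $1\le i\le s^{(q)}$, $1\le j\le s^{(m)}$), applied on a possibly non-uniform grid $t_0<t_1<\dots<t_N=t_F$ with $h_n=t_{n+1}-t_n$ and $h=\max_n h_n$, produces $y_0=y(t_0)$ and $$Y^{(q)}_{n,i}=y_n+h_n\sum_{m=1}^{P}\sum_{j=1}^{s^{(m)}}a^{(q,m)}_{i,j}f^{(m)}(Y^{(m)}_{n,j}),\qquad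 y_{n+1}=y_n+h_n\sum_{q=1}^{P}\sum_{i=1}^{s^{(q)}}b^{(q)}_i f^{(q)}(Y^{(q)}_{n,i}).$$ Its discrete adjoint equations are $\lambda_N=\bigl(Q_y(y_N)\bigr)^{\top}$ and, for $n=N-1,\dots,0$, $$\lambda_n=\lambda_{n+1}+\sum_{q=1}^{P}\sum_{i=1}^{s^{(q)}}\theta^{(q)}_{n,i},\qquad \theta^{(q)}_{n,i}=h_n\bigl(J^{(q)}(Y^{(q)}_{n,i})\bigr)^{\top}\Bigl(b^{(q)}_i\lambda_{n+1}+\sum_{m=1}^{P}\sum_{j=1}^{s^{(m)}}a^{(m,q)}_{j,i}\theta^{(m)}_{n,j}\Bigr).$$ Let $S_{t_2,t_1}(v)$ be the solution sensitivity matrix, that is, the derivative of the solution operator of $y'=F(y)$ from time $t_1$ to time $t_2$ at the state $v$. Assume: 1. For some constant $L$, $\|Q_y(v)-Q_y(w)\|\le L\|v-w\|$ for all $v,w\in\mathbb{R}^d$, and $\|S_{t_2,t_1}(v)-S_{t_2,t_1}(w)\|\le L\|v-w\|$ for all $t_0\le t_1\le t_2\le t_F$ and all $v,w$ from which a solution on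 $[t_1,t_2]$ exists. 2. The GARK scheme has order $p$: for every smooth $P$-component split system in any finite dimension, every exact solution $u$ of it on a compact interval, and all stage values in a given bounded set, a step of size $h$ from $u(t)$ has local error at most $Ch^{p+1}$ for all sufficiently small $h$, with $C$ independent of $t$. 3. A family of numerical solutions of the given system is given, on arbitrary grids of $[t_0,t_F]$, whose stage values stay bounded for small $h$ (as they do for explicit schemes; for implicit schemes this excludes spurious solutions of the stage equations that escape to infinity as $h\to0$), and which converges with order $p$: $y_n=y(t_n)+\mathcal{O}(h^p)$, uniformly in $n$ and over the family. Then for all sufficiently small $h$ the discrete adjoint equations are solvable, and every solution of them satisfies $$\lambda_n=\overline\lambda(t_n)+\mathcal{O}(h^p),$$ uniformly in $0\le n\le N$ and over the family. -/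

import Mathlib

open scoped ContDiff InnerProductSpace

noncomputable section

/-- `u` solves the autonomous system `u' = F(u)` on `[a, b]`
(one-sided derivatives at the end points). -/
def IsSolutionOn {E : Type*} [NormedAddCommGroup E] [NormedSpace ℝ E]
    (F : E → E) (a b : ℝ) (u : ℝ → E) : Prop :=
  ∀ t ∈ Set.Icc a b, HasDerivWithinAt u (F (u t)) (Set.Icc a b) t

/-- The right-hand side `F = ∑ q, f q` of an additively split system with `P` components. -/
def splitField {E : Type*} [NormedAddCommGroup E] {P : ℕ} (f : Fin P → E → E) : E → E :=
  fun y => ∑ q, f q y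

/-- There is a solution of `u' = F(u)` on `[t₁, t₂]` that starts at `u(t₁) = x`. -/
def ReachesTime {E : Type*} [NormedAddCommGroup E] [NormedSpace ℝ E]
    (F : E → E) (t₁ t₂ : ℝ) (x : E) : Prop :=
  ∃ u : ℝ → E, IsSolutionOn F t₁ t₂ u ∧ u t₁ = x

open Classical in
/-- The solution operator of `u' = F(u)`: it sends the state `x` at time `t₁` to the state at
time `t₂` (and has the dummy value `x` if there is no solution on `[t₁, t₂]`). -/
def solutionOperator {E : Type*} [NormedAddCommGroup E] [NormedSpace ℝ E]
    (F : E → E) (t₁ t₂ : ℝ) (x : E) : E :=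
  if hx : ReachesTime F t₁ t₂ x then hx.choose t₂ else x

/-- The solution sensitivity matrix `S_{t₂,t₁}(y) = d y(t₂) / d y(t₁)`, as a linear map:
the derivative of the solution operator. -/
def sensitivityMatrix {E : Type*} [NormedAddCommGroup E] [NormedSpace ℝ E]
    (F : E → E) (t₂ t₁ : ℝ) (y : E) : E →L[ℝ] E :=
  fderiv ℝ (solutionOperator F t₁ t₂) y

/-- The coefficients of a generalized-structure additive Runge-Kutta (GARK) scheme with `P`
components: `s q` stages for component `q`, coupling coefficients `a q m i j` and
weights `b q i`. -/
structure GARK (P : ℕ) where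
  s : Fin P → ℕ
  a : (q m : Fin P) → Fin (s q) → Fin (s m) → ℝ
  b : (q : Fin P) → Fin (s q) → ℝ

/-- One GARK step of size `h` from `y` to `y'` with stage values `Y q i`. -/
def GARK.IsStep {P : ℕ} (M : GARK P) {E : Type*} [NormedAddCommGroup E] [NormedSpace ℝ E]
    (f : Fin P → E → E) (h : ℝ) (y : E) (Y : (q : Fin P) → Fin (M.s q) → E) (y' : E) : Prop :=
  (∀ (q : Fin P) (i : Fin (M.s q)),
      Y q i = y + h • ∑ m, ∑ j, M.a q m i j • f m (Y m j)) ∧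
    y' = y + h • ∑ q, ∑ i, M.b q i • f q (Y q i)

/-- The scheme has order (at least) `p`: for every smooth split system, in any finite dimension,
and every exact solution `u` of it on a compact interval, a step of size `h` that starts on `u`
has local error `O(h ^ (p + 1))`. An implicit scheme may have spurious stage values that escape to
infinity as `h → 0`; the estimate is about stage values in an (arbitrary) bounded set. -/
def GARK.HasOrder {P : ℕ} (M : GARK P) (p : ℕ) : Prop :=
  ∀ (E : Type) [NormedAddCommGroup E] [NormedSpace ℝ E] [FiniteDimensional ℝ E]
    (f : Fin P → E → E), (∀ q, ContDiff ℝ ∞ (f q)) →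
    ∀ (a b : ℝ) (u : ℝ → E), IsSolutionOn (splitField f) a b u →
    ∀ R : ℝ, ∃ C h₀ : ℝ, 0 < h₀ ∧
      ∀ (t h : ℝ) (Y : (q : Fin P) → Fin (M.s q) → E) (y' : E),
        a ≤ t → 0 < h → h ≤ h₀ → t + h ≤ b →
        (∀ q i, ‖Y q i‖ ≤ R) → M.IsStep f h (u t) Y y' →
        ‖y' - u (t + h)‖ ≤ C * h ^ (p + 1)

/-- A time grid `t₀ = t 0 < t 1 < ⋯ < t N = tF`, possibly non-uniform; the values `t n` with
`n > N` are irrelevant. -/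
structure TimeGrid (t₀ tF : ℝ) where
  N : ℕ
  t : ℕ → ℝ
  t_zero : t 0 = t₀
  t_last : t N = tF
  t_lt : ∀ n < N, t n < t (n + 1)

/-- The step size `h_n = t_{n+1} - t_n`. -/
def TimeGrid.stepSize {t₀ tF : ℝ} (G : TimeGrid t₀ tF) (n : ℕ) : ℝ := G.t (n + 1) - G.t n

/-- The largest step size `h = max_n h_n`. -/
def TimeGrid.mesh {t₀ tF : ℝ} (G : TimeGrid t₀ tF) : ℝ := ⨆ n : Fin G.N, G.stepSize n

/-- A numerical solution of the split system `y' = ∑ q, f q (y)`, `y(t₀) = y₀`, computed by the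
GARK scheme `M` on some time grid of `[t₀, tF]`: the approximations `y n`, `n ≤ N`, and the stage
values `Y n q i`, `n < N`. -/
structure GARKSolution {P : ℕ} (M : GARK P) {E : Type*} [NormedAddCommGroup E] [NormedSpace ℝ E]
    (f : Fin P → E → E) (t₀ tF : ℝ) (y₀ : E) extends TimeGrid t₀ tF where
  y : ℕ → E
  Y : ℕ → (q : Fin P) → Fin (M.s q) → E
  y_zero : y 0 = y₀
  y_succ : ∀ n < N, M.IsStep f (toTimeGrid.stepSize n) (y n) (Y n) (y (n + 1))

/-- The discrete adjoint equations of the GARK scheme along the numerical solution `S`, with goal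
function `Q`; `lam n`, `n ≤ N`, are the discrete adjoints and `θ n q i`, `n < N`, the stage
multipliers. Transposes are Hilbert space adjoints, and `gradient Q` is the transpose of the
Jacobian of `Q`. -/
def GARKSolution.IsDiscreteAdjoint {P : ℕ} {M : GARK P} {d : ℕ}
    {f : Fin P → EuclideanSpace ℝ (Fin d) → EuclideanSpace ℝ (Fin d)} {t₀ tF : ℝ}
    {y₀ : EuclideanSpace ℝ (Fin d)} (S : GARKSolution M f t₀ tF y₀)
    (Q : EuclideanSpace ℝ (Fin d) → ℝ) (lam : ℕ → EuclideanSpace ℝ (Fin d))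
    (θ : ℕ → (q : Fin P) → Fin (M.s q) → EuclideanSpace ℝ (Fin d)) : Prop :=
  lam S.N = gradient Q (S.y S.N) ∧
    (∀ n < S.N, lam n = lam (n + 1) + ∑ q, ∑ i, θ n q i) ∧
    ∀ n < S.N, ∀ (q : Fin P) (i : Fin (M.s q)),
      θ n q i = S.toTimeGrid.stepSize n •
        (ContinuousLinearMap.adjoint (fderiv ℝ (f q) (S.Y n q i)))
          (M.b q i • lam (n + 1) + ∑ m, ∑ j, M.a m q j i • θ n m j)

/-- `lamBar` is the continuous adjoint on `[t₀, tF]` along the solution `y`: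
`lamBar' = - ∑ q, (J q (y t))ᵀ lamBar`, `lamBar(tF) = (Q_y(y(tF)))ᵀ`. -/
def IsContinuousAdjoint {P d : ℕ}
    (f : Fin P → EuclideanSpace ℝ (Fin d) → EuclideanSpace ℝ (Fin d))
    (Q : EuclideanSpace ℝ (Fin d) → ℝ) (t₀ tF : ℝ) (y lamBar : ℝ → EuclideanSpace ℝ (Fin d)) :
    Prop :=
  (∀ t ∈ Set.Icc t₀ tF,
      HasDerivWithinAt lamBar
        (-∑ q, (ContinuousLinearMap.adjoint (fderiv ℝ (f q) (y t))) (lamBar t))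
        (Set.Icc t₀ tF) t) ∧
    lamBar tF = gradient Q (y tF)

end

/-!
The discrete adjoint of one step is the transpose of the derivative of the numerical step map, and
that derivative is computed by applying the same scheme to the tangent linear system
`x' = ∑ q, f q x`, `X' = ∑ q, J q (x) X` (`GARK.IsStep.adjoint_apply_eq`). The tangent linear system
is again a smooth split system, so the order condition applies to it.

Let `Φ` be a fundamental matrix of `X' = ∑ q, J q (y(t)) X` along the exact solution `y`. The
continuous adjoint satisfies `Φ(t)ᵀ lamBar(t) = c` for all `t`. A tangent linear step from
`(y(tₙ), Φ(tₙ))` ends at `Φ(tₙ₊₁)` up to `O(hₙ ^ (p + 1))`. Starting at `(yₙ, Φ(tₙ))` instead changes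
the increment of the step by `O(hₙ) ‖yₙ - y(tₙ)‖ = O(hₙ h ^ p)`, because the stage values depend
Lipschitz continuously on the starting point (`GARK.HasOrder.exists_tangent_step`). Transposing,
`Φ(tₙ)ᵀ λₙ = Φ(tₙ₊₁)ᵀ λₙ₊₁ + O(hₙ h ^ p) ‖λₙ₊₁‖`. The terminal error is `O(h ^ p)` since `Q_y` is
Lipschitz, so a discrete Grönwall argument backwards in time shows `Φ(tₙ)ᵀ λₙ = c + O(h ^ p)`, and
`Φ(tₙ)ᵀ` is boundedly invertible (`norm_sub_le_of_transposed_steps`).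

Existence is a matter of contraction arguments: the tangent linear steps from bounded starting
points exist because the vector field may be cut off outside a ball, the stage multipliers exist
because their equations are linear with coefficients `O(h)`, and `Φ` exists on the whole interval
by Picard–Lindelöf for the cut-off linear equation.
-/

/-! ### Cut-off vector fields -/

open Metric in
/-- A smooth map on a finite-dimensional space agrees on any given ball with a globally Lipschitz
bounded map that is nowhere larger in norm. -/
theorem exists_lipschitz_cutoff {E F : Type*} [NormedAddCommGroup E] [NormedSpace ℝ E]
    [FiniteDimensional ℝ E] [NormedAddCommGroup F] [NormedSpace ℝ F] {g : E → F}
    (hg : ContDiff ℝ 1 g) (R : ℝ) :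
    ∃ (g' : E → F) (K : NNReal) (B : NNReal), LipschitzWith K g' ∧ (∀ x, ‖g' x‖ ≤ B) ∧
      (∀ x, ‖g' x‖ ≤ ‖g x‖) ∧ ∀ x, ‖x‖ ≤ R → g' x = g x := by
  let χ : ContDiffBump (0 : E) := ⟨max R 1, max R 1 + 1, by positivity, by linarith⟩
  have hsm : ContDiff ℝ 1 (fun x => χ x • g x) := χ.contDiff.smul hg
  have hcs : HasCompactSupport (fun x => χ x • g x) := χ.hasCompactSupport.smul_right
  obtain ⟨B, hB⟩ := hsm.continuous.bounded_above_of_compact_support hcs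
  obtain ⟨K, hK⟩ := (hsm.continuous_fderiv one_ne_zero).bounded_above_of_compact_support
    (hcs.fderiv ℝ)
  refine ⟨fun x => χ x • g x, K.toNNReal, B.toNNReal, ?_, fun x => (hB x).trans
    (Real.le_coe_toNNReal B), fun x => ?_, fun x hx => ?_⟩
  · refine lipschitzWith_of_nnnorm_fderiv_le (𝕜 := ℝ) (hsm.differentiable one_ne_zero) fun x => ?_
    rw [← NNReal.coe_le_coe, coe_nnnorm]
    exact (hK x).trans (Real.le_coe_toNNReal K)
  · rw [norm_smul, Real.norm_of_nonneg χ.nonneg]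
    exact mul_le_of_le_one_left (norm_nonneg _) χ.le_one
  · have : χ x = 1 := χ.one_of_mem_closedBall (by simpa [χ] using Or.inl hx)
    simp [this]

/-! ### Linear differential equations -/

open Set in
/-- A linear differential equation with continuous coefficients is solvable on the whole interval:
Picard–Lindelöf applies to the equation in which the state is cut off, and by Grönwall's inequality
the solution stays where the cut-off has no effect. -/
theorem exists_linear_ode_solution {F : Type*} [NormedAddCommGroup F] [NormedSpace ℝ F]
    [FiniteDimensional ℝ F] {a b : ℝ} (hab : a ≤ b) {B : ℝ → F →L[ℝ] F}
    (hB : ContinuousOn B (Icc a b)) (x₀ : F) :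
    ∃ X : ℝ → F, X a = x₀ ∧ ∀ t ∈ Icc a b, HasDerivWithinAt X (B t (X t)) (Icc a b) t := by
  have : CompleteSpace F := FiniteDimensional.complete ℝ F
  obtain ⟨K, hK⟩ := isCompact_Icc.exists_bound_of_continuousOn hB
  have hK0 : 0 ≤ K := (norm_nonneg _).trans (hK a (left_mem_Icc.2 hab))
  lift K to NNReal using hK0
  -- The radius of the ball on which `φ` is the identity is the Grönwall bound of the solution.
  obtain ⟨φ, Kφ, Bφ, hφL, hφB, hφle, hφeq⟩ :=
    exists_lipschitz_cutoff (contDiff_id (𝕜 := ℝ) (E := F)) (‖x₀‖ * Real.exp (K * (b - a)))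
  have hpl : IsPicardLindelof (fun t x => B t (φ x)) (⟨a, left_mem_Icc.2 hab⟩ : Icc a b) x₀
      (K * Bφ * (b - a).toNNReal) 0 (K * Bφ) (K * Kφ) := by
    refine ⟨fun t ht => ?_, fun x _ => ?_, fun t ht x _ => ?_, ?_⟩
    · refine (LipschitzWith.comp (ContinuousLinearMap.lipschitzWith_of_opNorm_le
        (f := B t) (hK t ht)) hφL).lipschitzOnWith
    · exact hB.clm_apply continuousOn_const
    · push_cast
      exact (B t).le_of_opNorm_le_of_le (hK t ht) (hφB x)
    · simp [Real.coe_toNNReal _ (sub_nonneg.2 hab), hab]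
  obtain ⟨X, hX0, hX⟩ := hpl.exists_eq_forall_mem_Icc_hasDerivWithinAt₀
  refine ⟨X, hX0, fun t ht => ?_⟩
  have hgr := norm_le_gronwallBound_of_norm_deriv_right_le (f := X) (δ := ‖x₀‖) (K := K) (ε := 0)
    (fun t ht => (hX t ht).continuousWithinAt)
    (fun t ht => (hX t ⟨ht.1, ht.2.le⟩).mono_of_mem_nhdsWithin
      (Icc_mem_nhdsGE_of_mem ht)) (by simp [hX0])
    (fun t ht => by
      simpa using (B t).le_of_opNorm_le_of_le (hK t ⟨ht.1, ht.2.le⟩) (hφle (X t))) t ht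
  have hle : ‖X t‖ ≤ ‖x₀‖ * Real.exp (K * (b - a)) := by
    rw [gronwallBound_ε0] at hgr
    refine hgr.trans ?_
    gcongr
    exact ht.2
  have := hX t ht
  rwa [hφeq _ hle] at this

open Set in
/-- A function with vanishing derivative within `[a, b]` is constant there. -/
theorem eq_of_hasDerivWithinAt_zero {F : Type*} [NormedAddCommGroup F] [NormedSpace ℝ F]
    {a b : ℝ} {X : ℝ → F} (hX : ∀ t ∈ Icc a b, HasDerivWithinAt X 0 (Icc a b) t) :
    ∀ t ∈ Icc a b, X t = X a :=
  constant_of_has_deriv_right_zero (fun t ht => (hX t ht).continuousWithinAt)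
    fun t ht => (hX t ⟨ht.1, ht.2.le⟩).mono_of_mem_nhdsWithin (Icc_mem_nhdsGE_of_mem ht)

open Set in
/-- The fundamental matrix `Φ` of `x' = A(t) x`, together with its inverse `Ψ`, which is the solution
of `Ψ' = -Ψ A`. -/
theorem exists_fundamental_matrix {E : Type*} [NormedAddCommGroup E] [NormedSpace ℝ E]
    [FiniteDimensional ℝ E] {a b : ℝ} (hab : a ≤ b) {A : ℝ → E →L[ℝ] E}
    (hA : ContinuousOn A (Icc a b)) :
    ∃ Φ Ψ : ℝ → E →L[ℝ] E,
      (∀ t ∈ Icc a b, HasDerivWithinAt Φ ((A t).comp (Φ t)) (Icc a b) t) ∧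
      ContinuousOn Ψ (Icc a b) ∧ ∀ t ∈ Icc a b, (Φ t).comp (Ψ t) = .id ℝ E := by
  obtain ⟨Φ, hΦa, hΦ⟩ := exists_linear_ode_solution hab
    (B := fun t => ContinuousLinearMap.compL ℝ E E E (A t))
    ((ContinuousLinearMap.compL ℝ E E E).continuous.comp_continuousOn hA) (.id ℝ E)
  obtain ⟨Ψ, hΨa, hΨ⟩ := exists_linear_ode_solution hab
    (B := fun t => -((ContinuousLinearMap.compL ℝ E E E).flip (A t)))
    ((ContinuousLinearMap.compL ℝ E E E).flip.continuous.comp_continuousOn hA).neg (.id ℝ E)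
  refine ⟨Φ, Ψ, hΦ, fun t ht => (hΨ t ht).continuousWithinAt, fun t ht => ?_⟩
  have hconst := eq_of_hasDerivWithinAt_zero (X := fun t => (Ψ t).comp (Φ t)) (fun t ht => by
    convert! (hΨ t ht).clm_comp (hΦ t ht) using 1
    ext v
    simp) t ht
  have h1 : (Ψ t).comp (Φ t) = .id ℝ E := by simpa [hΦa, hΨa] using hconst
  -- In finite dimension a left inverse is also a right inverse.
  have h2 : (Ψ t : E →ₗ[ℝ] E) * (Φ t : E →ₗ[ℝ] E) = 1 := by
    ext v
    simpa using congrArg (fun T : E →L[ℝ] E => T v) h1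
  have h3 := (mul_eq_one_comm).1 h2
  ext v
  simpa using congrArg (fun T : E →ₗ[ℝ] E => T v) h3

/-! ### Solvability and stability of the stage equations -/

/-- The sum of the absolute values of all coefficients of the scheme. -/
def GARK.coeffSum {P : ℕ} (M : GARK P) : ℝ :=
  ∑ q, ∑ i, (|M.b q i| + ∑ m, ∑ j, |M.a q m i j|)

namespace GARK

variable {P : ℕ} (M : GARK P)

theorem coeffSum_nonneg : 0 ≤ M.coeffSum :=
  Finset.sum_nonneg fun _ _ => Finset.sum_nonneg fun _ _ => add_nonneg (abs_nonneg _)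
    (Finset.sum_nonneg fun _ _ => Finset.sum_nonneg fun _ _ => abs_nonneg _)

theorem weight_add_row_le_coeffSum (q : Fin P) (i : Fin (M.s q)) :
    |M.b q i| + ∑ m, ∑ j, |M.a q m i j| ≤ M.coeffSum := by
  have hnn : ∀ q i, 0 ≤ |M.b q i| + ∑ m, ∑ j, |M.a q m i j| := fun q i =>
    add_nonneg (abs_nonneg _)
      (Finset.sum_nonneg fun _ _ => Finset.sum_nonneg fun _ _ => abs_nonneg _)
  exact (Finset.single_le_sum (f := fun i => |M.b q i| + ∑ m, ∑ j, |M.a q m i j|)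
    (fun i _ => hnn q i) (Finset.mem_univ i)).trans
    (Finset.single_le_sum (f := fun q => ∑ i, (|M.b q i| + ∑ m, ∑ j, |M.a q m i j|))
    (fun q _ => Finset.sum_nonneg fun i _ => hnn q i) (Finset.mem_univ q))

theorem sum_abs_row_le_coeffSum (q : Fin P) (i : Fin (M.s q)) :
    ∑ m, ∑ j, |M.a q m i j| ≤ M.coeffSum := by
  linarith [M.weight_add_row_le_coeffSum q i, abs_nonneg (M.b q i)]

theorem sum_abs_weight_le_coeffSum : ∑ q, ∑ i, |M.b q i| ≤ M.coeffSum :=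
  Finset.sum_le_sum fun _ _ => Finset.sum_le_sum fun _ _ =>
    le_add_of_nonneg_right (Finset.sum_nonneg fun _ _ => Finset.sum_nonneg fun _ _ => abs_nonneg _)

theorem sum_abs_column_le_coeffSum (q : Fin P) (i : Fin (M.s q)) :
    ∑ m, ∑ j, |M.a m q j i| ≤ M.coeffSum := by
  refine Finset.sum_le_sum fun m _ => Finset.sum_le_sum fun j _ => ?_
  have h1 : |M.a m q j i| ≤ ∑ i', |M.a m q j i'| :=
    Finset.single_le_sum (f := fun i' => |M.a m q j i'|) (fun _ _ => abs_nonneg _)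
      (Finset.mem_univ i)
  have h2 : ∑ i', |M.a m q j i'| ≤ ∑ q', ∑ i', |M.a m q' j i'| :=
    Finset.single_le_sum (f := fun q' => ∑ i', |M.a m q' j i'|)
      (fun _ _ => Finset.sum_nonneg fun _ _ => abs_nonneg _) (Finset.mem_univ q)
  linarith [abs_nonneg (M.b m j)]

/-- A linear combination over all stages is bounded by the sum of its coefficients. -/
theorem norm_sum_smul_le {F : Type*} [NormedAddCommGroup F] [NormedSpace ℝ F]
    {c : (m : Fin P) → Fin (M.s m) → ℝ} (hc : ∑ m, ∑ j, |c m j| ≤ M.coeffSum)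
    {v : (m : Fin P) → Fin (M.s m) → F} {r : ℝ} (hr : 0 ≤ r) (hv : ∀ m j, ‖v m j‖ ≤ r) :
    ‖∑ m, ∑ j, c m j • v m j‖ ≤ M.coeffSum * r := by
  refine le_trans ?_ (mul_le_mul_of_nonneg_right hc hr)
  rw [Finset.sum_mul]
  refine norm_sum_le_of_le _ fun m _ => ?_
  rw [Finset.sum_mul]
  refine norm_sum_le_of_le _ fun j _ => ?_
  rw [norm_smul, Real.norm_eq_abs]
  exact mul_le_mul_of_nonneg_left (hv m j) (abs_nonneg _)

end GARK

/-- The real-number form of the Banach fixed point theorem with contraction factor `1 / 2`. -/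
theorem exists_fixedPoint_of_norm_sub_le {V : Type*} [NormedAddCommGroup V] [CompleteSpace V]
    (G : V → V) (hG : ∀ x y, ‖G x - G y‖ ≤ 1 / 2 * ‖x - y‖) : ∃ x, G x = x := by
  have hc : ContractingWith (1 / 2 : NNReal) G := by
    refine ⟨by rw [← NNReal.coe_lt_coe]; norm_num, LipschitzWith.of_dist_le_mul fun x y => ?_⟩
    simpa [dist_eq_norm] using hG x y
  exact ⟨_, hc.fixedPoint_isFixedPt⟩

/-- `exists_lipschitz_cutoff`, with constants that serve all components of a split system. -/
theorem exists_lipschitz_cutoff_family {E : Type*} [NormedAddCommGroup E] [NormedSpace ℝ E]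
    [FiniteDimensional ℝ E] {P : ℕ} {f : Fin P → E → E} (hf : ∀ q, ContDiff ℝ 1 (f q)) (R : ℝ) :
    ∃ (g : Fin P → E → E) (K B : ℝ), 0 ≤ K ∧ 0 ≤ B ∧ (∀ q x y, ‖g q x - g q y‖ ≤ K * ‖x - y‖) ∧
      (∀ q x, ‖g q x‖ ≤ B) ∧ ∀ q x, ‖x‖ ≤ R → g q x = f q x := by
  choose g K B hL hB _ hg using fun q => exists_lipschitz_cutoff (hf q) R
  refine ⟨g, (∑ q, K q : NNReal), (∑ q, B q : NNReal), NNReal.coe_nonneg _, NNReal.coe_nonneg _,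
    fun q x y => ?_, fun q x => ?_, hg⟩
  · refine (LipschitzWith.norm_sub_le (hL q) x y).trans ?_
    gcongr
    exact Finset.single_le_sum (f := K) (fun _ _ => zero_le) (Finset.mem_univ q)
  · refine (hB q x).trans ?_
    exact_mod_cast Finset.single_le_sum (f := B) (fun _ _ => zero_le) (Finset.mem_univ q)

namespace GARK

variable {P : ℕ} (M : GARK P) {E : Type*} [NormedAddCommGroup E] [NormedSpace ℝ E]
  [FiniteDimensional ℝ E] {f : Fin P → E → E}

/-- Small steps from a ball of radius `r` are possible, with stage values in the ball of radius
`r + 1`. -/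
theorem exists_isStep (hf : ∀ q, ContDiff ℝ 1 (f q)) (r : ℝ) :
    ∃ h₀ > 0, ∀ z : E, ‖z‖ ≤ r → ∀ h, 0 < h → h ≤ h₀ →
      ∃ Y z', M.IsStep f h z Y z' ∧ ∀ q i, ‖Y q i‖ ≤ r + 1 := by
  have : CompleteSpace E := FiniteDimensional.complete ℝ E
  obtain ⟨g, K, B, hK, hB, hgL, hgB, hgf⟩ := exists_lipschitz_cutoff_family hf (r + 1)
  have hκ := M.coeffSum_nonneg
  have hpos : 0 < 2 * (M.coeffSum * (K + B) + 1) := by positivity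
  refine ⟨1 / (2 * (M.coeffSum * (K + B) + 1)), by positivity, fun z hz h hh hh₀ => ?_⟩
  rw [le_div_iff₀ hpos] at hh₀
  have hhK : h * (M.coeffSum * K) ≤ 1 / 2 := by
    nlinarith [mul_nonneg hh.le (mul_nonneg hκ hB)]
  have hhB : h * (M.coeffSum * B) ≤ 1 / 2 := by
    nlinarith [mul_nonneg hh.le (mul_nonneg hκ hK)]
  obtain ⟨Y, hY⟩ := exists_fixedPoint_of_norm_sub_le
    (fun (Y : (q : Fin P) → Fin (M.s q) → E) q i =>
      z + h • ∑ m, ∑ j, M.a q m i j • g m (Y m j)) fun Y W => by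
    have hr : 0 ≤ 1 / 2 * ‖Y - W‖ := by positivity
    refine (pi_norm_le_iff_of_nonneg hr).2 fun q => (pi_norm_le_iff_of_nonneg hr).2 fun i => ?_
    have hd : ∀ m j, ‖g m (Y m j) - g m (W m j)‖ ≤ K * ‖Y - W‖ := fun m j =>
      (hgL m _ _).trans (mul_le_mul_of_nonneg_left
        ((norm_le_pi_norm ((Y - W) m) j).trans (norm_le_pi_norm (Y - W) m)) hK)
    have := M.norm_sum_smul_le (M.sum_abs_row_le_coeffSum q i) (by positivity) hd
    simp only [Pi.sub_apply, add_sub_add_left_eq_sub, ← smul_sub, ← Finset.sum_sub_distrib]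
    rw [norm_smul, Real.norm_of_nonneg hh.le]
    nlinarith [mul_le_mul_of_nonneg_left this hh.le,
      mul_le_mul_of_nonneg_right hhK (norm_nonneg (Y - W))]
  have hY' : ∀ q i, Y q i = z + h • ∑ m, ∑ j, M.a q m i j • g m (Y m j) := fun q i =>
    (congrFun (congrFun hY q) i).symm
  have hYr : ∀ q i, ‖Y q i‖ ≤ r + 1 := fun q i => by
    have := M.norm_sum_smul_le (M.sum_abs_row_le_coeffSum q i) hB fun m j => hgB m (Y m j)
    rw [hY']
    refine (norm_add_le _ _).trans ?_
    rw [norm_smul, Real.norm_of_nonneg hh.le]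
    nlinarith [mul_le_mul_of_nonneg_left this hh.le]
  refine ⟨Y, _, ⟨fun q i => ?_, rfl⟩, hYr⟩
  rw [hY']
  simp only [hgf _ _ (hYr _ _)]

/-- Stage values in a bounded set depend Lipschitz continuously on the starting point of the step,
and the increments of a step of size `h` do so with a constant `O(h)`. -/
theorem isStep_stability (hf : ∀ q, ContDiff ℝ 1 (f q)) (R : ℝ) :
    ∃ K h₀ : ℝ, 0 ≤ K ∧ 0 < h₀ ∧ ∀ (h : ℝ) (z w z' w' : E) (Y W : (q : Fin P) → Fin (M.s q) → E),
      0 < h → h ≤ h₀ → M.IsStep f h z Y z' → M.IsStep f h w W w' →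
      (∀ q i, ‖Y q i‖ ≤ R) → (∀ q i, ‖W q i‖ ≤ R) →
      (∀ q i, ‖Y q i - W q i‖ ≤ 2 * ‖z - w‖) ∧ ‖(z' - z) - (w' - w)‖ ≤ K * h * ‖z - w‖ := by
  obtain ⟨g, K, _, hK, _, hgL, _, hgf⟩ := exists_lipschitz_cutoff_family hf R
  have hκ := M.coeffSum_nonneg
  have hpos : 0 < 2 * (M.coeffSum * K + 1) := by positivity
  refine ⟨2 * (M.coeffSum * K), 1 / (2 * (M.coeffSum * K + 1)), by positivity, by positivity,
    fun h z w z' w' Y W hh hh₀ hY hW hYR hWR => ?_⟩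
  rw [le_div_iff₀ hpos] at hh₀
  have hd : ∀ m j, ‖f m (Y m j) - f m (W m j)‖ ≤ K * ‖Y - W‖ := fun m j => by
    rw [← hgf m _ (hYR m j), ← hgf m _ (hWR m j)]
    exact (hgL m _ _).trans (mul_le_mul_of_nonneg_left
      ((norm_le_pi_norm ((Y - W) m) j).trans (norm_le_pi_norm (Y - W) m)) hK)
  have hYW : ‖Y - W‖ ≤ ‖z - w‖ + 1 / 2 * ‖Y - W‖ := by
    have hr : 0 ≤ ‖z - w‖ + 1 / 2 * ‖Y - W‖ := by positivity
    refine (pi_norm_le_iff_of_nonneg hr).2 fun q => (pi_norm_le_iff_of_nonneg hr).2 fun i => ?_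
    have := M.norm_sum_smul_le (M.sum_abs_row_le_coeffSum q i) (by positivity) hd
    rw [Pi.sub_apply, Pi.sub_apply, hY.1 q i, hW.1 q i, add_sub_add_comm, ← smul_sub]
    simp only [← Finset.sum_sub_distrib, ← smul_sub]
    refine (norm_add_le _ _).trans ?_
    rw [norm_smul, Real.norm_of_nonneg hh.le]
    nlinarith [mul_le_mul_of_nonneg_left this hh.le,
      mul_nonneg hh.le (norm_nonneg (Y - W)),
      mul_le_mul_of_nonneg_right hh₀ (norm_nonneg (Y - W))]
  refine ⟨fun q i => ?_, ?_⟩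
  · have := (norm_le_pi_norm ((Y - W) q) i).trans (norm_le_pi_norm (Y - W) q)
    simp only [Pi.sub_apply] at this
    linarith
  · have := M.norm_sum_smul_le M.sum_abs_weight_le_coeffSum (by positivity) hd
    rw [hY.2, hW.2, add_sub_cancel_left, add_sub_cancel_left, ← smul_sub]
    simp only [← Finset.sum_sub_distrib, ← smul_sub]
    rw [norm_smul, Real.norm_of_nonneg hh.le]
    calc h * _ ≤ h * (M.coeffSum * (K * ‖Y - W‖)) := by gcongr
      _ ≤ h * (M.coeffSum * (K * (2 * ‖z - w‖))) := by gcongr; linarith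
      _ = _ := by ring

end GARK

/-! ### The tangent linear system -/

/-- Component `q` of the split system formed by `x' = ∑ q, f q x` and its matrix variational
equation `X' = ∑ q, J q (x) X`. -/
noncomputable def tangentField {E : Type*} [NormedAddCommGroup E] [NormedSpace ℝ E] {P : ℕ}
    (f : Fin P → E → E) (q : Fin P) (z : E × (E →L[ℝ] E)) : E × (E →L[ℝ] E) :=
  (f q z.1, (fderiv ℝ (f q) z.1).comp z.2)

section Tangent

variable {E : Type*} [NormedAddCommGroup E] [NormedSpace ℝ E] {P : ℕ} {f : Fin P → E → E}

theorem contDiff_tangentField (hf : ∀ q, ContDiff ℝ ∞ (f q)) (q : Fin P) :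
    ContDiff ℝ ∞ (tangentField f q) :=
  ((hf q).comp contDiff_fst).prodMk
    ((((hf q).fderiv_right (m := ∞) le_rfl).comp contDiff_fst).clm_comp contDiff_snd)

theorem isSolutionOn_tangentField {a b : ℝ} {y : ℝ → E} (hy : IsSolutionOn (splitField f) a b y)
    {Φ : ℝ → E →L[ℝ] E} (hΦ : ∀ t ∈ Set.Icc a b,
      HasDerivWithinAt Φ ((∑ q, fderiv ℝ (f q) (y t)).comp (Φ t)) (Set.Icc a b) t) :
    IsSolutionOn (splitField (tangentField f)) a b fun t => (y t, Φ t) := by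
  intro t ht
  have hval : splitField (tangentField f) (y t, Φ t) =
      (splitField f (y t), (∑ q, fderiv ℝ (f q) (y t)).comp (Φ t)) := by
    refine Prod.ext ?_ ?_
    · simp [splitField, tangentField, Prod.fst_sum]
    · ext v
      simp [splitField, tangentField, Prod.snd_sum]
  simpa only [hval] using (hy t ht).prodMk (hΦ t ht)

/-- The first component of a step for the tangent linear system is a step for the system itself. -/
theorem GARK.IsStep.fst {M : GARK P} {h : ℝ} {z z' : E × (E →L[ℝ] E)}
    {Z : (q : Fin P) → Fin (M.s q) → E × (E →L[ℝ] E)}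
    (hZ : M.IsStep (tangentField f) h z Z z') :
    M.IsStep f h z.1 (fun q i => (Z q i).1) z'.1 := by
  refine ⟨fun q i => ?_, ?_⟩
  · change (Z q i).1 = _
    conv_lhs => rw [hZ.1 q i]
    simp [tangentField, Prod.fst_sum]
  · conv_lhs => rw [hZ.2]
    simp [tangentField, Prod.fst_sum]

theorem GARK.IsStep.snd_stage_apply {M : GARK P} {h : ℝ} {z z' : E × (E →L[ℝ] E)}
    {Z : (q : Fin P) → Fin (M.s q) → E × (E →L[ℝ] E)}
    (hZ : M.IsStep (tangentField f) h z Z z') (v : E) (q : Fin P) (i : Fin (M.s q)) :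
    (Z q i).2 v = z.2 v +
      h • ∑ m, ∑ j, M.a q m i j • fderiv ℝ (f m) (Z m j).1 ((Z m j).2 v) := by
  conv_lhs => rw [hZ.1 q i]
  simp [tangentField, Prod.snd_sum]

theorem GARK.IsStep.snd_apply {M : GARK P} {h : ℝ} {z z' : E × (E →L[ℝ] E)}
    {Z : (q : Fin P) → Fin (M.s q) → E × (E →L[ℝ] E)}
    (hZ : M.IsStep (tangentField f) h z Z z') (v : E) :
    z'.2 v = z.2 v + h • ∑ q, ∑ i, M.b q i • fderiv ℝ (f q) (Z q i).1 ((Z q i).2 v) := by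
  conv_lhs => rw [hZ.2]
  simp [tangentField, Prod.snd_sum]

end Tangent

/-- One step of the tangent linear scheme along a numerical solution `yₙ` that is `η`-close to the
exact solution at time `t`, started with the fundamental matrix `Φ t`, has error `O(h η)` (for
`h ^ p ≤ η`). The step is compared with the one that starts on the exact solution: that step has
error `O(h ^ (p + 1))` since the scheme has order `p` for the tangent linear system, and the
increments of the two steps differ by `O(h)` times the distance of the starting points. -/
theorem GARK.HasOrder.exists_tangent_step {E : Type} [NormedAddCommGroup E] [NormedSpace ℝ E]
    [FiniteDimensional ℝ E] {P : ℕ} {M : GARK P} {p : ℕ} (hM : M.HasOrder p) {f : Fin P → E → E}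
    (hf : ∀ q, ContDiff ℝ ∞ (f q)) {t₀ tF : ℝ} {y : ℝ → E}
    (hy : IsSolutionOn (splitField f) t₀ tF y) {Φ : ℝ → E →L[ℝ] E}
    (hΦ : ∀ t ∈ Set.Icc t₀ tF,
      HasDerivWithinAt Φ ((∑ q, fderiv ℝ (f q) (y t)).comp (Φ t)) (Set.Icc t₀ tF) t)
    (R η₀ : ℝ) :
    ∃ C h₀ : ℝ, 0 ≤ C ∧ 0 < h₀ ∧ ∀ (t h η : ℝ) (yₙ y' : E) (Y : (q : Fin P) → Fin (M.s q) → E),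
      t₀ ≤ t → 0 < h → h ≤ h₀ → t + h ≤ tF → h ^ p ≤ η → η ≤ η₀ → M.IsStep f h yₙ Y y' →
      (∀ q i, ‖Y q i‖ ≤ R) → ‖yₙ - y t‖ ≤ η →
      ∃ Z z', M.IsStep (tangentField f) h (yₙ, Φ t) Z z' ∧ (∀ q i, (Z q i).1 = Y q i) ∧
        ‖z'.2 - Φ (t + h)‖ ≤ C * h * η := by
  have hsol := isSolutionOn_tangentField hy hΦ
  obtain ⟨r, hr⟩ := isCompact_Icc.exists_bound_of_continuousOn
    (fun t ht => (hsol t ht).continuousWithinAt : ContinuousOn (fun t => (y t, Φ t)) _)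
  have hf1 : ∀ q, ContDiff ℝ 1 (f q) := fun q => (hf q).of_le (mod_cast le_top)
  have hT1 : ∀ q, ContDiff ℝ 1 (tangentField f q) := fun q =>
    (contDiff_tangentField hf q).of_le (mod_cast le_top)
  obtain ⟨h₁, hh₁, hex⟩ := M.exists_isStep hT1 (r + |η₀|)
  set R' := max R (r + |η₀| + 1)
  obtain ⟨C₂, h₂, hh₂, hord⟩ := hM _ _ (contDiff_tangentField hf) t₀ tF _ hsol R'
  obtain ⟨K₃, h₃, hK₃, hh₃, hstab⟩ := M.isStep_stability hT1 R'
  obtain ⟨_, h₄, _, hh₄, huniq⟩ := M.isStep_stability hf1 R'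
  refine ⟨|C₂| + K₃, min (min h₁ h₂) (min h₃ h₄), by positivity, by positivity,
    fun t h η yₙ y' Y ht hh hh₀ hth hpη hη hY hYR hyη => ?_⟩
  simp only [le_min_iff] at hh₀
  obtain ⟨⟨hh1, hh2⟩, hh3, hh4⟩ := hh₀
  have htm : t ∈ Set.Icc t₀ tF := ⟨ht, by linarith⟩
  have hη0 : 0 ≤ η := (norm_nonneg _).trans hyη
  have hsub : (yₙ, Φ t) - (y t, Φ t) = (yₙ - y t, 0) := by simp
  have hdist : ‖(yₙ, Φ t) - (y t, Φ t)‖ = ‖yₙ - y t‖ := by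
    rw [hsub, Prod.norm_mk, norm_zero, max_eq_left (norm_nonneg _)]
  have hstart : ‖(yₙ, Φ t)‖ ≤ r + |η₀| := by
    have h1 := norm_le_norm_add_norm_sub' (yₙ, Φ t) (y t, Φ t)
    have h2 := hr t htm
    rw [hdist] at h1
    linarith [le_abs_self η₀]
  -- `Z` are the stages of the step from the numerical solution, `W` those of the reference step from
  -- the exact solution.
  obtain ⟨Z, z', hZ, hZR⟩ := hex (yₙ, Φ t) hstart h hh hh1
  obtain ⟨W, w', hW, hWR⟩ := hex (y t, Φ t)
    ((hr t htm).trans (le_add_of_nonneg_right (abs_nonneg _))) h hh hh1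
  replace hZR : ∀ q i, ‖Z q i‖ ≤ R' := fun q i => (hZR q i).trans (le_max_right _ _)
  replace hWR : ∀ q i, ‖W q i‖ ≤ R' := fun q i => (hWR q i).trans (le_max_right _ _)
  refine ⟨Z, z', hZ, fun q i => ?_, ?_⟩
  -- Bounded stage values of the original system are unique for small `h`.
  · have := (huniq h yₙ yₙ _ _ _ Y hh hh4 hZ.fst hY
      (fun q i => (norm_fst_le _).trans (hZR q i))
      (fun q i => (hYR q i).trans (le_max_left _ _))).1 q i
    rw [sub_self, norm_zero, mul_zero, norm_le_zero_iff, sub_eq_zero] at this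
    exact this
  · have h1 := (norm_snd_le _).trans (hord t h W w' ht hh hh2 hth hWR hW)
    have h2 := (norm_snd_le _).trans
      (hstab h _ _ z' w' Z W hh hh3 hZ hW hZR hWR).2
    rw [hdist] at h2
    simp only [Prod.snd_sub, sub_sub_sub_cancel_right] at h1 h2
    calc ‖z'.2 - Φ (t + h)‖ ≤ ‖z'.2 - w'.2‖ + ‖w'.2 - Φ (t + h)‖ :=
          norm_sub_le_norm_sub_add_norm_sub ..
      _ ≤ K₃ * h * ‖yₙ - y t‖ + C₂ * h ^ (p + 1) := add_le_add h2 h1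
      _ ≤ K₃ * h * η + |C₂| * (h * η) := by
        rw [pow_succ']
        gcongr
        exact le_abs_self _
      _ = _ := by ring

/-! ### The discrete adjoint equations -/

section Adjoint

variable {d P : ℕ} {f : Fin P → EuclideanSpace ℝ (Fin d) → EuclideanSpace ℝ (Fin d)}

open ContinuousLinearMap (adjoint adjoint_inner_left)

/-- A step of the discrete adjoint is the transpose of a step of the tangent linear scheme with the
same stage values. -/
theorem GARK.IsStep.adjoint_apply_eq {M : GARK P} {h : ℝ}
    {z z' : EuclideanSpace ℝ (Fin d) × (EuclideanSpace ℝ (Fin d) →L[ℝ] EuclideanSpace ℝ (Fin d))}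
    {Z : (q : Fin P) → Fin (M.s q) →
      EuclideanSpace ℝ (Fin d) × (EuclideanSpace ℝ (Fin d) →L[ℝ] EuclideanSpace ℝ (Fin d))}
    (hZ : M.IsStep (tangentField f) h z Z z') {l l' : EuclideanSpace ℝ (Fin d)}
    {θ : (q : Fin P) → Fin (M.s q) → EuclideanSpace ℝ (Fin d)}
    (hl : l = l' + ∑ q, ∑ i, θ q i)
    (hθ : ∀ q i, θ q i = h • adjoint (fderiv ℝ (f q) (Z q i).1)
      (M.b q i • l' + ∑ m, ∑ j, M.a m q j i • θ m j)) :
    adjoint z.2 l = adjoint z'.2 l' := by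
  refine ext_inner_right ℝ fun v => ?_
  rw [adjoint_inner_left, adjoint_inner_left, hZ.snd_apply, hl]
  obtain ⟨D, hD⟩ : ∃ D : (q : Fin P) → Fin (M.s q) → EuclideanSpace ℝ (Fin d),
      ∀ q i, D q i = fderiv ℝ (f q) (Z q i).1 ((Z q i).2 v) := ⟨_, fun _ _ => rfl⟩
  simp only [← hD]
  -- The multipliers are tested against the tangent stages in two ways: by their own equation, and
  -- by the equation of the tangent stages.
  have h1 : ∑ q, ∑ i, ⟪θ q i, (Z q i).2 v⟫_ℝ =
      h * ∑ q, ∑ i, M.b q i * ⟪l', D q i⟫_ℝ +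
        h * ∑ q, ∑ i, ∑ m, ∑ j, M.a m q j i * ⟪θ m j, D q i⟫_ℝ := by
    simp only [Finset.mul_sum, ← Finset.sum_add_distrib]
    refine Finset.sum_congr rfl fun q _ => Finset.sum_congr rfl fun i _ => ?_
    rw [hθ q i, real_inner_smul_left, adjoint_inner_left, inner_add_left, real_inner_smul_left,
      sum_inner]
    simp only [sum_inner, real_inner_smul_left, mul_add, Finset.mul_sum, hD]
  have h2 : ∑ q, ∑ i, ⟪θ q i, (Z q i).2 v⟫_ℝ =
      ∑ q, ∑ i, ⟪θ q i, z.2 v⟫_ℝ +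
        h * ∑ q, ∑ i, ∑ m, ∑ j, M.a q m i j * ⟪θ q i, D m j⟫_ℝ := by
    simp only [Finset.mul_sum, ← Finset.sum_add_distrib]
    refine Finset.sum_congr rfl fun q _ => Finset.sum_congr rfl fun i _ => ?_
    rw [hZ.snd_stage_apply v q i, inner_add_right, real_inner_smul_right]
    simp only [inner_sum, real_inner_smul_right, Finset.mul_sum, hD]
  have h3 : ∑ q, ∑ i, ∑ m, ∑ j, M.a m q j i * ⟪θ m j, D q i⟫_ℝ =
      ∑ q, ∑ i, ∑ m, ∑ j, M.a q m i j * ⟪θ q i, D m j⟫_ℝ := by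
    have hswap : ∀ q, ∑ i, ∑ m, ∑ j, M.a m q j i * ⟪θ m j, D q i⟫_ℝ =
        ∑ m, ∑ j, ∑ i, M.a m q j i * ⟪θ m j, D q i⟫_ℝ := fun q => by
      rw [Finset.sum_comm]
      exact Finset.sum_congr rfl fun m _ => Finset.sum_comm
    rw [Finset.sum_congr rfl fun q _ => hswap q, Finset.sum_comm]
    exact Finset.sum_congr rfl fun m _ => Finset.sum_comm
  rw [h3] at h1
  rw [inner_add_left, inner_add_right, sum_inner, real_inner_smul_right, inner_sum]
  simp only [sum_inner, inner_sum, real_inner_smul_right]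
  linarith

/-- For small step sizes the equations of the stage multipliers are solvable. -/
theorem GARK.exists_stage_multipliers (M : GARK P) (hf : ∀ q, ContDiff ℝ 1 (f q)) (R : ℝ) :
    ∃ h₀ > 0, ∀ (h : ℝ) (Y : (q : Fin P) → Fin (M.s q) → EuclideanSpace ℝ (Fin d)),
      0 < h → h ≤ h₀ → (∀ q i, ‖Y q i‖ ≤ R) → ∀ l : EuclideanSpace ℝ (Fin d),
      ∃ θ : (q : Fin P) → Fin (M.s q) → EuclideanSpace ℝ (Fin d), ∀ q i,
        θ q i = h • adjoint (fderiv ℝ (f q) (Y q i))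
          (M.b q i • l + ∑ m, ∑ j, M.a m q j i • θ m j) := by
  have hbd : ∀ q, ∃ K, ∀ x ∈ Metric.closedBall (0 : EuclideanSpace ℝ (Fin d)) R,
      ‖fderiv ℝ (f q) x‖ ≤ K := fun q =>
    (isCompact_closedBall _ _).exists_bound_of_continuousOn
      ((hf q).continuous_fderiv one_ne_zero).continuousOn
  choose k hk using hbd
  set K := ∑ q, |k q|
  have hK0 : 0 ≤ K := Finset.sum_nonneg fun _ _ => abs_nonneg _
  have hκ := M.coeffSum_nonneg
  have hpos : 0 < 2 * (M.coeffSum * K + 1) := by positivity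
  refine ⟨1 / (2 * (M.coeffSum * K + 1)), by positivity, fun h Y hh hh₀ hY l => ?_⟩
  rw [le_div_iff₀ hpos] at hh₀
  have hJ : ∀ q i, ‖adjoint (fderiv ℝ (f q) (Y q i))‖ ≤ K := fun q i => by
    rw [LinearIsometryEquiv.norm_map]
    exact ((hk q _ (mem_closedBall_zero_iff.2 (hY q i))).trans (le_abs_self _)).trans
      (Finset.single_le_sum (f := fun q => |k q|) (fun _ _ => abs_nonneg _) (Finset.mem_univ q))
  obtain ⟨θ, hθ⟩ := exists_fixedPoint_of_norm_sub_le
    (fun (θ : (q : Fin P) → Fin (M.s q) → EuclideanSpace ℝ (Fin d)) q i =>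
      h • adjoint (fderiv ℝ (f q) (Y q i))
        (M.b q i • l + ∑ m, ∑ j, M.a m q j i • θ m j)) fun θ ξ => by
    have hr : 0 ≤ 1 / 2 * ‖θ - ξ‖ := by positivity
    refine (pi_norm_le_iff_of_nonneg hr).2 fun q => (pi_norm_le_iff_of_nonneg hr).2 fun i => ?_
    have hd : ∀ m j, ‖θ m j - ξ m j‖ ≤ ‖θ - ξ‖ := fun m j =>
      (norm_le_pi_norm ((θ - ξ) m) j).trans (norm_le_pi_norm (θ - ξ) m)
    have hsum := M.norm_sum_smul_le (M.sum_abs_column_le_coeffSum q i) (norm_nonneg _) hd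
    have happ := (adjoint (fderiv ℝ (f q) (Y q i))).le_of_opNorm_le_of_le (hJ q i) hsum
    simp only [Pi.sub_apply, ← smul_sub, ← map_sub, add_sub_add_left_eq_sub,
      ← Finset.sum_sub_distrib]
    rw [norm_smul, Real.norm_of_nonneg hh.le]
    calc h * _ ≤ h * (K * (M.coeffSum * ‖θ - ξ‖)) := by gcongr
      _ ≤ 1 / 2 * ‖θ - ξ‖ := by
        nlinarith [mul_le_mul_of_nonneg_right hh₀ (norm_nonneg (θ - ξ)),
          mul_nonneg hh.le (norm_nonneg (θ - ξ))]
  exact ⟨θ, fun q i => (congrFun (congrFun hθ q) i).symm⟩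

/-- The discrete adjoint equations are solvable if the stage multipliers of each step are. -/
theorem GARKSolution.exists_isDiscreteAdjoint {M : GARK P} {t₀ tF : ℝ}
    {y₀ : EuclideanSpace ℝ (Fin d)} (S : GARKSolution M f t₀ tF y₀)
    (Q : EuclideanSpace ℝ (Fin d) → ℝ)
    (hS : ∀ n < S.N, ∀ l, ∃ θ : (q : Fin P) → Fin (M.s q) → EuclideanSpace ℝ (Fin d), ∀ q i,
      θ q i = S.stepSize n • adjoint (fderiv ℝ (f q) (S.Y n q i))
        (M.b q i • l + ∑ m, ∑ j, M.a m q j i • θ m j)) :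
    ∃ lam θ, S.IsDiscreteAdjoint Q lam θ := by
  have hS' : ∀ n l, ∃ θ : (q : Fin P) → Fin (M.s q) → EuclideanSpace ℝ (Fin d), n < S.N → ∀ q i,
      θ q i = S.stepSize n • adjoint (fderiv ℝ (f q) (S.Y n q i))
        (M.b q i • l + ∑ m, ∑ j, M.a m q j i • θ m j) := fun n l => by
    by_cases hn : n < S.N
    · exact (hS n hn l).imp fun _ h _ => h
    · exact ⟨0, fun h => absurd h hn⟩
  choose T hT using hS'
  -- `l k` is the discrete adjoint `k` steps before the final time.
  let l : ℕ → EuclideanSpace ℝ (Fin d) := fun k => Nat.rec (gradient Q (S.y S.N))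
    (fun k v => v + ∑ q, ∑ i, T (S.N - 1 - k) v q i) k
  refine ⟨fun n => l (S.N - n), fun n => T n (l (S.N - (n + 1))), ?_, fun n hn => ?_,
    fun n hn => hT n _ hn⟩
  · simp [l]
  · have h1 : S.N - n = S.N - (n + 1) + 1 := by omega
    have h2 : S.N - 1 - (S.N - (n + 1)) = n := by omega
    simp only [h1]
    change l (S.N - (n + 1)) + ∑ q, ∑ i, T (S.N - 1 - (S.N - (n + 1))) (l (S.N - (n + 1))) q i = _
    rw [h2]

end Adjoint

/-! ### Time grids and error propagation -/

theorem TimeGrid.stepSize_pos {t₀ tF : ℝ} (G : TimeGrid t₀ tF) {n : ℕ} (hn : n < G.N) :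
    0 < G.stepSize n :=
  sub_pos.2 (G.t_lt n hn)

theorem TimeGrid.stepSize_le_mesh {t₀ tF : ℝ} (G : TimeGrid t₀ tF) {n : ℕ} (hn : n < G.N) :
    G.stepSize n ≤ G.mesh :=
  le_ciSup (f := fun n : Fin G.N => G.stepSize n) (Set.finite_range _).bddAbove ⟨n, hn⟩

theorem TimeGrid.mesh_nonneg {t₀ tF : ℝ} (G : TimeGrid t₀ tF) : 0 ≤ G.mesh :=
  Real.iSup_nonneg fun n => (G.stepSize_pos n.2).le

theorem TimeGrid.mem_Icc {t₀ tF : ℝ} (G : TimeGrid t₀ tF) {n : ℕ} (hn : n ≤ G.N) :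
    G.t n ∈ Set.Icc t₀ tF := by
  constructor
  · refine G.t_zero.symm.le.trans ?_
    induction n with
    | zero => exact le_rfl
    | succ n ih => exact (ih (by omega)).trans (G.t_lt n (by omega)).le
  · refine le_trans ?_ G.t_last.le
    induction hn using Nat.decreasingInduction with
    | self => exact le_rfl
    | of_succ n hn ih => exact (G.t_lt n hn).le.trans ih

/-- Discrete Grönwall inequality for a recursion that runs backwards in time. -/
theorem discrete_gronwall_backward {N : ℕ} {e t : ℕ → ℝ} {κ δ : ℝ} (hκ : 0 ≤ κ) (hδ : 0 ≤ δ)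
    (ht : ∀ n < N, t n ≤ t (n + 1)) (heN : 0 ≤ e N)
    (he : ∀ n < N, e n ≤ (1 + κ * (t (n + 1) - t n)) * e (n + 1) + κ * (t (n + 1) - t n) * δ)
    {n : ℕ} (hn : n ≤ N) :
    e n ≤ Real.exp (κ * (t N - t n)) * (e N + κ * (t N - t n) * δ) := by
  suffices h : t n ≤ t N ∧ e n ≤ Real.exp (κ * (t N - t n)) * (e N + κ * (t N - t n) * δ) from h.2
  induction hn using Nat.decreasingInduction with
  | self => simp
  | of_succ n hn ih =>
    obtain ⟨htN, ih⟩ := ih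
    have hs : 0 ≤ t (n + 1) - t n := sub_nonneg.2 (ht n hn)
    have hs' : 0 ≤ t N - t (n + 1) := sub_nonneg.2 htN
    refine ⟨(ht n hn).trans htN, (he n hn).trans ?_⟩
    have hexp : Real.exp (κ * (t N - t n)) =
        Real.exp (κ * (t (n + 1) - t n)) * Real.exp (κ * (t N - t (n + 1))) := by
      rw [← Real.exp_add]
      ring_nf
    have h1 : 1 + κ * (t (n + 1) - t n) ≤ Real.exp (κ * (t (n + 1) - t n)) := by
      linarith [Real.add_one_le_exp (κ * (t (n + 1) - t n))]
    have h2 : 1 ≤ Real.exp (κ * (t N - t n)) :=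
      Real.one_le_exp (mul_nonneg hκ (by linarith))
    calc _ ≤ Real.exp (κ * (t (n + 1) - t n)) *
          (Real.exp (κ * (t N - t (n + 1))) * (e N + κ * (t N - t (n + 1)) * δ)) +
          Real.exp (κ * (t N - t n)) * (κ * (t (n + 1) - t n) * δ) := by
          refine add_le_add ?_ (le_mul_of_one_le_left (by positivity) h2)
          refine (mul_le_mul_of_nonneg_left ih (by positivity)).trans ?_
          exact mul_le_mul_of_nonneg_right h1 (by positivity)
      _ = _ := by rw [hexp]; ring

section Adjoint

variable {d P : ℕ} {f : Fin P → EuclideanSpace ℝ (Fin d) → EuclideanSpace ℝ (Fin d)}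

open ContinuousLinearMap (adjoint adjoint_inner_left)

/-- The pairing of the continuous adjoint with any solution of the variational equation is constant
in time. -/
theorem IsContinuousAdjoint.adjoint_apply_eq {Q : EuclideanSpace ℝ (Fin d) → ℝ} {t₀ tF : ℝ}
    {y lamBar : ℝ → EuclideanSpace ℝ (Fin d)} (hl : IsContinuousAdjoint f Q t₀ tF y lamBar)
    {Φ : ℝ → EuclideanSpace ℝ (Fin d) →L[ℝ] EuclideanSpace ℝ (Fin d)}
    (hΦ : ∀ t ∈ Set.Icc t₀ tF,
      HasDerivWithinAt Φ ((∑ q, fderiv ℝ (f q) (y t)).comp (Φ t)) (Set.Icc t₀ tF) t)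
    {t : ℝ} (ht : t ∈ Set.Icc t₀ tF) :
    adjoint (Φ t) (lamBar t) = adjoint (Φ t₀) (lamBar t₀) := by
  refine ext_inner_right ℝ fun v => ?_
  rw [adjoint_inner_left, adjoint_inner_left]
  refine eq_of_hasDerivWithinAt_zero (X := fun t => ⟪lamBar t, Φ t v⟫_ℝ) (fun t ht => ?_) t ht
  have h1 : HasDerivWithinAt (fun t => Φ t v) (((∑ q, fderiv ℝ (f q) (y t)).comp (Φ t)) v)
      (Set.Icc t₀ tF) t := by
    simpa using (hΦ t ht).clm_apply (hasDerivWithinAt_const t (Set.Icc t₀ tF) v)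
  convert! (hl.1 t ht).inner ℝ h1 using 1
  simp [inner_sum, sum_inner, adjoint_inner_left]

theorem norm_gradient_sub_gradient (Q : EuclideanSpace ℝ (Fin d) → ℝ)
    (v w : EuclideanSpace ℝ (Fin d)) :
    ‖gradient Q v - gradient Q w‖ = ‖fderiv ℝ Q v - fderiv ℝ Q w‖ := by
  rw [gradient, gradient, ← map_sub, LinearIsometryEquiv.norm_map]

/-- Error propagation for the discrete adjoint. The vectors `Φₙᵀ μₙ` are all equal to `c`, while
`Φₙᵀ λₙ = Xᵀ λₙ₊₁` with a matrix `X` that is `Φₙ₊₁` up to an error of size `C hₙ η`, so that the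
vectors `Φₙᵀ λₙ` are nearly constant. Backwards from `n = N` this gives `λₙ - μₙ = O(η)` if
`λ_N - μ_N = O(η)`. -/
theorem norm_sub_le_of_transposed_steps {N : ℕ} {t : ℕ → ℝ} (ht : ∀ n < N, t n ≤ t (n + 1))
    {Φ Ψ : ℕ → EuclideanSpace ℝ (Fin d) →L[ℝ] EuclideanSpace ℝ (Fin d)} {bΨ C η η₀ : ℝ}
    (hΦΨ : ∀ n ≤ N, (Φ n).comp (Ψ n) = .id ℝ _) (hΨ : ∀ n ≤ N, ‖Ψ n‖ ≤ bΨ)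
    (hC : 0 ≤ C) (hη : 0 ≤ η) (hη₀ : η ≤ η₀) (h1 : 1 ≤ η₀)
    {lam mu : ℕ → EuclideanSpace ℝ (Fin d)} {c : EuclideanSpace ℝ (Fin d)}
    (hmu : ∀ n ≤ N, adjoint (Φ n) (mu n) = c)
    (hstep : ∀ n < N, ∃ X : EuclideanSpace ℝ (Fin d) →L[ℝ] EuclideanSpace ℝ (Fin d),
      adjoint (Φ n) (lam n) = adjoint X (lam (n + 1)) ∧
        ‖X - Φ (n + 1)‖ ≤ C * (t (n + 1) - t n) * η)
    {n : ℕ} (hn : n ≤ N) :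
    ‖lam n - mu n‖ ≤ bΨ * (Real.exp (C * bΨ * η₀ * (t N - t n)) *
      (‖Φ N‖ * ‖lam N - mu N‖ + C * bΨ * η₀ * (t N - t n) * (η * ‖c‖))) := by
  have hb0 : 0 ≤ bΨ := (norm_nonneg _).trans (hΨ n hn)
  have hinv : ∀ n ≤ N, ∀ v, ‖v‖ ≤ bΨ * ‖adjoint (Φ n) v‖ := fun n hn v => by
    have hv : adjoint (Ψ n) (adjoint (Φ n) v) = v := by
      refine ext_inner_right ℝ fun w => ?_
      rw [adjoint_inner_left, adjoint_inner_left, ← ContinuousLinearMap.comp_apply, hΦΨ n hn,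
        ContinuousLinearMap.id_apply]
    calc ‖v‖ = ‖adjoint (Ψ n) (adjoint (Φ n) v)‖ := by rw [hv]
      _ ≤ _ := ContinuousLinearMap.le_of_opNorm_le _
        (by rw [LinearIsometryEquiv.norm_map]; exact hΨ n hn) _
  have happ : ∀ (T : EuclideanSpace ℝ (Fin d) →L[ℝ] EuclideanSpace ℝ (Fin d)) v,
      ‖adjoint T v‖ ≤ ‖T‖ * ‖v‖ := fun T v => by
    simpa only [LinearIsometryEquiv.norm_map] using (adjoint T).le_opNorm v
  have hrec : ∀ n < N, ‖adjoint (Φ n) (lam n) - c‖ ≤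
      (1 + C * bΨ * η₀ * (t (n + 1) - t n)) * ‖adjoint (Φ (n + 1)) (lam (n + 1)) - c‖ +
        C * bΨ * η₀ * (t (n + 1) - t n) * (η * ‖c‖) := fun n hn => by
    obtain ⟨X, hX, hXe⟩ := hstep n hn
    have hs : 0 ≤ t (n + 1) - t n := sub_nonneg.2 (ht n hn)
    set m := adjoint (Φ (n + 1)) (lam (n + 1))
    have hsplit : adjoint (Φ n) (lam n) - c = (m - c) + adjoint (X - Φ (n + 1)) (lam (n + 1)) := by
      rw [hX, map_sub, sub_apply]
      abel
    have hm : ‖m‖ ≤ ‖m - c‖ + ‖c‖ := norm_le_norm_sub_add _ _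
    have hdef : ‖adjoint (X - Φ (n + 1)) (lam (n + 1))‖ ≤
        C * (t (n + 1) - t n) * η * (bΨ * (‖m - c‖ + ‖c‖)) :=
      (happ _ _).trans (mul_le_mul hXe ((hinv (n + 1) hn _).trans
        (mul_le_mul_of_nonneg_left hm hb0)) (norm_nonneg _) (by positivity))
    rw [hsplit]
    refine (norm_add_le _ _).trans ?_
    have hw : 0 ≤ C * bΨ * (t (n + 1) - t n) := by positivity
    -- The factor `η₀` in the rate of growth bounds `η` in the first term and absorbs `1` in the second.
    have e1 : C * bΨ * (t (n + 1) - t n) * (η * ‖m - c‖) ≤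
        C * bΨ * (t (n + 1) - t n) * (η₀ * ‖m - c‖) := by gcongr
    have e2 : C * bΨ * (t (n + 1) - t n) * (1 * (η * ‖c‖)) ≤
        C * bΨ * (t (n + 1) - t n) * (η₀ * (η * ‖c‖)) := by gcongr
    linarith
  have hgr := discrete_gronwall_backward (e := fun n => ‖adjoint (Φ n) (lam n) - c‖)
    (by positivity : 0 ≤ C * bΨ * η₀) (by positivity : 0 ≤ η * ‖c‖) ht (norm_nonneg _) hrec hn
  have hsub : ∀ n ≤ N, adjoint (Φ n) (lam n - mu n) = adjoint (Φ n) (lam n) - c := fun n hn => by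
    rw [map_sub, hmu n hn]
  have hN := happ (Φ N) (lam N - mu N)
  rw [hsub N le_rfl] at hN
  refine (hinv n hn _).trans (mul_le_mul_of_nonneg_left ?_ hb0)
  rw [hsub n hn]
  refine hgr.trans (mul_le_mul_of_nonneg_left ?_ (Real.exp_pos _).le)
  simpa using hN

end Adjoint

/-! ### Convergence of the discrete adjoint -/

/-- The numerical solutions form an arbitrary family `S k`, one for each grid of the family; the
`O(h ^ p)` terms are uniform over the family and over `n`, for all sufficiently small `h`. -/
theorem mainTheorem1 {P d : ℕ} (M : GARK P) (p : ℕ)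
    (f : Fin P → EuclideanSpace ℝ (Fin d) → EuclideanSpace ℝ (Fin d))
    (hf : ∀ q, ContDiff ℝ ∞ (f q))
    (Q : EuclideanSpace ℝ (Fin d) → ℝ) (hQ : Differentiable ℝ Q)
    (t₀ tF : ℝ) (ht : t₀ < tF)
    (y : ℝ → EuclideanSpace ℝ (Fin d)) (hy : IsSolutionOn (splitField f) t₀ tF y)
    (lamBar : ℝ → EuclideanSpace ℝ (Fin d)) (hlamBar : IsContinuousAdjoint f Q t₀ tF y lamBar)
    (L : ℝ)
    (hSLip : ∀ t₁ t₂ : ℝ, t₀ ≤ t₁ → t₁ ≤ t₂ → t₂ ≤ tF → ∀ v w : EuclideanSpace ℝ (Fin d),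
      ReachesTime (splitField f) t₁ t₂ v → ReachesTime (splitField f) t₁ t₂ w →
      ‖sensitivityMatrix (splitField f) t₂ t₁ v - sensitivityMatrix (splitField f) t₂ t₁ w‖ ≤
        L * ‖v - w‖)
    (hQLip : ∀ v w : EuclideanSpace ℝ (Fin d), ‖fderiv ℝ Q v - fderiv ℝ Q w‖ ≤ L * ‖v - w‖)
    (hM : M.HasOrder p)
    {ι : Type*} (S : ι → GARKSolution M f t₀ tF (y t₀))
    (hstages : ∃ R h₀ : ℝ, 0 < h₀ ∧ ∀ k, (S k).mesh ≤ h₀ →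
      ∀ n < (S k).N, ∀ q i, ‖(S k).Y n q i‖ ≤ R)
    (hconv : ∃ C h₀ : ℝ, 0 < h₀ ∧ ∀ k, (S k).mesh ≤ h₀ →
      ∀ n ≤ (S k).N, ‖(S k).y n - y ((S k).t n)‖ ≤ C * (S k).mesh ^ p) :
    ∃ C h₀ : ℝ, 0 < h₀ ∧ ∀ k, (S k).mesh ≤ h₀ →
      (∃ lam θ, (S k).IsDiscreteAdjoint Q lam θ) ∧
      ∀ lam θ, (S k).IsDiscreteAdjoint Q lam θ →
        ∀ n ≤ (S k).N, ‖lam n - lamBar ((S k).t n)‖ ≤ C * (S k).mesh ^ p := by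
  obtain ⟨R, h₁, hh₁, hR⟩ := hstages
  obtain ⟨C₂, h₂, hh₂, hC₂⟩ := hconv
  have hf1 : ∀ q, ContDiff ℝ 1 (f q) := fun q => (hf q).of_le (mod_cast le_top)
  have hyc : ContinuousOn y (Set.Icc t₀ tF) := fun t ht => (hy t ht).continuousWithinAt
  obtain ⟨Φ, Ψ, hΦ, hΨ, hΦΨ⟩ := exists_fundamental_matrix ht.le
    (A := fun t => ∑ q, fderiv ℝ (f q) (y t)) (continuousOn_finsetSum _ fun q _ =>
      ((hf1 q).continuous_fderiv one_ne_zero).comp_continuousOn hyc)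
  obtain ⟨bΨ, hbΨ⟩ := isCompact_Icc.exists_bound_of_continuousOn hΨ
  have hb0 : 0 ≤ bΨ := (norm_nonneg _).trans (hbΨ t₀ (Set.left_mem_Icc.2 ht.le))
  -- `η = η₀ h ^ p` will bound both the error of the numerical solution and `hₙ ^ p`.
  set η₀ := max C₂ 1
  obtain ⟨C₃, h₃, hC₃, hh₃, hstep⟩ := hM.exists_tangent_step hf hy hΦ R η₀
  obtain ⟨h₄, hh₄, hθ⟩ := M.exists_stage_multipliers hf1 R
  set c := ContinuousLinearMap.adjoint (Φ t₀) (lamBar t₀)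
  set κ := C₃ * bΨ * η₀
  refine ⟨bΨ * (Real.exp (κ * (tF - t₀)) * (‖Φ tF‖ * |L| + κ * (tF - t₀) * ‖c‖)) * η₀,
    min (min (min h₁ h₂) (min h₃ h₄)) 1, by positivity, fun k hk => ?_⟩
  simp only [le_min_iff] at hk
  obtain ⟨⟨⟨hk1, hk2⟩, hk3, hk4⟩, hk5⟩ := hk
  refine ⟨(S k).exists_isDiscreteAdjoint Q fun n hn l => hθ _ _ ((S k).stepSize_pos hn)
    (((S k).stepSize_le_mesh hn).trans hk4) (hR k hk1 n hn) l, fun lam θ hlam n hn => ?_⟩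
  have hmesh := (S k).mesh_nonneg
  have hη₀ : 1 ≤ η₀ := le_max_right _ _
  set η := η₀ * (S k).mesh ^ p with hη
  have hpow : (S k).mesh ^ p ≤ η := le_mul_of_one_le_left (by positivity) hη₀
  have hηle : η ≤ η₀ := mul_le_of_le_one_right (by positivity) (pow_le_one₀ hmesh hk5)
  have hη0 : 0 ≤ η := by positivity
  have hclose : ∀ n ≤ (S k).N, ‖(S k).y n - y ((S k).t n)‖ ≤ η := fun n hn =>
    (hC₂ k hk2 n hn).trans (mul_le_mul_of_nonneg_right (le_max_left _ _) (by positivity))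
  have hprop := norm_sub_le_of_transposed_steps (fun n hn => ((S k).t_lt n hn).le)
    (Φ := fun n => Φ ((S k).t n)) (Ψ := fun n => Ψ ((S k).t n)) (bΨ := bΨ) (lam := lam)
    (mu := fun n => lamBar ((S k).t n)) (c := c)
    (fun n hn => hΦΨ _ ((S k).mem_Icc hn)) (fun n hn => hbΨ _ ((S k).mem_Icc hn)) hC₃ hη0 hηle hη₀
    (fun n hn => hlamBar.adjoint_apply_eq hΦ ((S k).mem_Icc hn)) (fun n hn => ?_) hn
  · have hlast : ‖lam (S k).N - lamBar tF‖ ≤ |L| * η := by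
      rw [hlam.1, hlamBar.2, norm_gradient_sub_gradient]
      have h := hclose _ le_rfl
      rw [(S k).t_last] at h
      exact (hQLip _ _).trans (mul_le_mul (le_abs_self L) h (norm_nonneg _) (abs_nonneg _))
    have htn := (S k).mem_Icc hn
    have hκ : 0 ≤ κ := by positivity
    have hT : 0 ≤ tF - (S k).t n := sub_nonneg.2 htn.2
    rw [(S k).t_last] at hprop
    calc ‖lam n - lamBar ((S k).t n)‖
        ≤ bΨ * (Real.exp (κ * (tF - (S k).t n)) *
          (‖Φ tF‖ * ‖lam (S k).N - lamBar tF‖ + κ * (tF - (S k).t n) * (η * ‖c‖))) := hprop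
      _ ≤ bΨ * (Real.exp (κ * (tF - t₀)) *
          (‖Φ tF‖ * (|L| * η) + κ * (tF - t₀) * (η * ‖c‖))) := by
        have := htn.1
        gcongr
      _ = _ := by rw [hη]; ring
  · have hnext : (S k).t n + (S k).stepSize n = (S k).t (n + 1) := by
      simp [TimeGrid.stepSize]
    have hpos := (S k).stepSize_pos hn
    have hle := (S k).stepSize_le_mesh hn
    obtain ⟨Z, z', hZ, hZY, hz'⟩ := hstep ((S k).t n) ((S k).stepSize n) η _ _ _
      ((S k).mem_Icc hn.le).1 hpos (hle.trans hk3)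
      (hnext ▸ ((S k).mem_Icc (Nat.succ_le_of_lt hn)).2)
      ((pow_le_pow_left₀ hpos.le hle p).trans hpow) hηle ((S k).y_succ n hn) (hR k hk1 n hn)
      (hclose n hn.le)
    rw [hnext] at hz'
    refine ⟨z'.2, hZ.adjoint_apply_eq (hlam.2.1 n hn) fun q i => ?_, hz'⟩
    rw [hZY]
    exact hlam.2.2 n hn q i
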